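/- Let $1\le q\le k$, let $M_{x_1},\dots,M_{x_N}\in\mathbb R^{k\times k}$ be symmetric positive semidefinite matrices (the information matrices of the design points), let $g:\mathbb R^k\to\mathbb R^q$ be differentiable at $\theta$ with Jacobian matrix $J=\partial g(\theta)/\partial\theta^T$, and let $0\le p<\infty$, $0<\epsilon<1$, $0<r<1$, $u>0$. Put $\Omega_\epsilon=\{w\in\mathbb R^N: 0\le w_i\le\epsilon,\ \sum_i w_i=1\}$, $M(w)=\sum_{i=1}^N w_iM_{x_i}$, $\Omega_\epsilon^+=\{w\in\Omega_\epsilon: M(w)>0\}$ (positive definite), $\Sigma_g(w)=JM(w)^{-1}J^T$ where $M(w)>0$, and $\Phi_p(\Sigma)=(q^{-1}\mathrm{Tr}\,\Sigma^p)^{1/p}$ for $p>0$, $\Phi_0(\Sigma)=|\Sigma|^{1/q}$. For $w$ with $M(w)>0$ and $w'\in\Omega_\epsilon$ let $\eta(w',w)$ and $\tau(0,w',w)$ be the first and second derivatives at $\alpha=0$ of $\alpha\mapsto\Phi_p(\Sigma_g((1-\alpha)w+\alpha w'))$. A steepest gradient (SG) measure of $w$ is a minimizer of $\eta(\cdot,w)$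 over $\Omega_\epsilon$; a positive steepest gradient (PSG) measure of $w$ is a minimizer of $\eta(\cdot,w)$ over $\Omega_\epsilon^+$. Let $(w^t)_{t\ge0}$ be iterates of the hybrid algorithm, that is, for some number $T$ of boost steps (determined by any stopping rule): 1. $w^0$ is an SG measure of the uniform measure $(1/N,\dots,1/N)$, and $M(w^0)>0$. 2. (Boost.) For $1\le t\le T$, $w^t=(1-\alpha^*)w^{t-1}+\alpha^*\tilde w^{t-1}$, where $\tilde w^{t-1}$ is an SG measure of $w^{t-1}$ and $$\alpha^*=\min\Big[r,\ \max\Big(0,\ \frac{-\eta(\tilde w^{t-1},w^{t-1})}{\tau(0,\tilde w^{t-1},w^{t-1})+u}\Big)\Big].$$ 3. (Algorithm 2, started at $w^T$ and run indefinitely.) For $t>T$, $\tilde w^{t-1}$ is a PSG measure of $w^{t-1}$, and $w^t$ minimizes $\Phi_p(\Sigma_g(w))$ over all $w\in\Omega_\epsilon^+$ such that $w_i=\epsilon$ whenever $w^{t-1}_i=\tilde w^{t-1}_i=\epsilon$, and $w_i=0$ whenever $w^{t-1}_i=\tilde w^{t-1}_i=0$. Let $\hat w\in\Omega_\epsilon^+$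 be a solution of $\min_{w}\Phi_p(\Sigma_g(w))$, the minimum being over the $w\in\Omega_\epsilon$ at which $\Sigma_g(w)$ is defined (that is, over $\Omega_\epsilon^+$). Then $$\lim_{t\to\infty}\Phi_p(\Sigma_g(w^t))=\Phi_p(\Sigma_g(\hat w)).$$ -/

import Mathlib

open Filter Topology

noncomputable section

namespace PhiDesign

variable {N k q : ℕ}

/-- The Jacobian matrix `∂g(θ)/∂θᵀ` of `g : ℝᵏ → ℝ^q` at `θ`. -/
def jacobian (g : (Fin k → ℝ) → (Fin q → ℝ)) (θ : Fin k → ℝ) : Matrix (Fin q) (Fin k) ℝ :=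
  LinearMap.toMatrix' (fderiv ℝ g θ : (Fin k → ℝ) →ₗ[ℝ] (Fin q → ℝ))

/-- The information matrix `M(w) = ∑ᵢ wᵢ M_{xᵢ}`; `Mx i` is the information matrix of the
`i`-th design point. -/
def info (Mx : Fin N → Matrix (Fin k) (Fin k) ℝ) (w : Fin N → ℝ) : Matrix (Fin k) (Fin k) ℝ :=
  ∑ i, w i • Mx i

/-- `Σ_g(w) = J M(w)⁻¹ Jᵀ` with `J` the Jacobian of `g`.  It is only used where `M(w)` is positive
definite. -/
def covar (Mx : Fin N → Matrix (Fin k) (Fin k) ℝ) (J : Matrix (Fin q) (Fin k) ℝ)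
    (w : Fin N → ℝ) : Matrix (Fin q) (Fin q) ℝ :=
  J * (info Mx w)⁻¹ * J.transpose

/-- Kiefer's criterion `Φ_p(S) = (q⁻¹ Tr S^p)^{1/p}` for `0 < p < ∞`, and its limit `|S|^{1/q}` for
`p = 0`.  The power `S^p` of a positive semidefinite matrix is taken by functional calculus. -/
def Phi (p : ℝ) (S : Matrix (Fin q) (Fin q) ℝ) : ℝ :=
  if p = 0 then S.det ^ (1 / (q : ℝ))
  else ((q : ℝ)⁻¹ * (cfc (fun t : ℝ => t ^ p) S).trace) ^ (1 / p)

/-- The objective function `w ↦ Φ_p(Σ_g(w))`. -/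
def objective (p : ℝ) (Mx : Fin N → Matrix (Fin k) (Fin k) ℝ) (J : Matrix (Fin q) (Fin k) ℝ)
    (w : Fin N → ℝ) : ℝ :=
  Phi p (covar Mx J w)

/-- `Ω_ε`: probability vectors with all weights at most `ε`. -/
def Omega (N : ℕ) (ε : ℝ) : Set (Fin N → ℝ) :=
  {w | (∀ i, 0 ≤ w i ∧ w i ≤ ε) ∧ ∑ i, w i = 1}

/-- `Ω_ε⁺`: the measures in `Ω_ε` with positive definite information matrix, i.e. those at which
`Σ_g` is defined. -/
def OmegaPos (Mx : Fin N → Matrix (Fin k) (Fin k) ℝ) (ε : ℝ) : Set (Fin N → ℝ) :=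
  {w | w ∈ Omega N ε ∧ (info Mx w).PosDef}

/-- `w` minimizes the objective over the part of `C` where the objective is defined. -/
def Minimizes (p ε : ℝ) (Mx : Fin N → Matrix (Fin k) (Fin k) ℝ) (J : Matrix (Fin q) (Fin k) ℝ)
    (C : Set (Fin N → ℝ)) (w : Fin N → ℝ) : Prop :=
  w ∈ C ∩ OmegaPos Mx ε ∧
    ∀ w' ∈ C ∩ OmegaPos Mx ε, objective p Mx J w ≤ objective p Mx J w'

/-- `w` solves the problem `min_{w ∈ Ω_ε} Φ_p(Σ_g(w))`. -/
def Solves (p ε : ℝ) (Mx : Fin N → Matrix (Fin k) (Fin k) ℝ) (J : Matrix (Fin q) (Fin k) ℝ)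
    (w : Fin N → ℝ) : Prop :=
  Minimizes p ε Mx J Set.univ w

/-- The objective along the line from `w` (at `α = 0`) to `w'` (at `α = 1`). -/
def along (p : ℝ) (Mx : Fin N → Matrix (Fin k) (Fin k) ℝ) (J : Matrix (Fin q) (Fin k) ℝ)
    (w' w : Fin N → ℝ) (α : ℝ) : ℝ :=
  objective p Mx J ((1 - α) • w + α • w')

/-- `η(w', w)`: the directional derivative of the objective at `w` towards `w'`. -/
def eta (p : ℝ) (Mx : Fin N → Matrix (Fin k) (Fin k) ℝ) (J : Matrix (Fin q) (Fin k) ℝ)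
    (w' w : Fin N → ℝ) : ℝ :=
  deriv (along p Mx J w' w) 0

/-- `τ(α, w', w)`: the second derivative of the objective along the line from `w` to `w'`. -/
def tau (p : ℝ) (Mx : Fin N → Matrix (Fin k) (Fin k) ℝ) (J : Matrix (Fin q) (Fin k) ℝ)
    (α : ℝ) (w' w : Fin N → ℝ) : ℝ :=
  iteratedDeriv 2 (along p Mx J w' w) α

/-- `w'` is a steepest gradient (SG) measure of `w`: it minimizes `η(·, w)` over `Ω_ε`. -/
def IsSG (p ε : ℝ) (Mx : Fin N → Matrix (Fin k) (Fin k) ℝ) (J : Matrix (Fin q) (Fin k) ℝ)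
    (w' w : Fin N → ℝ) : Prop :=
  w' ∈ Omega N ε ∧ ∀ v ∈ Omega N ε, eta p Mx J w' w ≤ eta p Mx J v w

/-- `w'` is a positive steepest gradient (PSG) measure of `w`: it minimizes `η(·, w)` over
`Ω_ε⁺`. -/
def IsPSG (p ε : ℝ) (Mx : Fin N → Matrix (Fin k) (Fin k) ℝ) (J : Matrix (Fin q) (Fin k) ℝ)
    (w' w : Fin N → ℝ) : Prop :=
  w' ∈ OmegaPos Mx ε ∧ ∀ v ∈ OmegaPos Mx ε, eta p Mx J w' w ≤ eta p Mx J v w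

/-- The boost step size
`α* = min[r, max(0, -η(w', w) / (τ(0, w', w) + u))]`. -/
def boostStep (p r u : ℝ) (Mx : Fin N → Matrix (Fin k) (Fin k) ℝ) (J : Matrix (Fin q) (Fin k) ℝ)
    (w' w : Fin N → ℝ) : ℝ :=
  min r (max 0 (-eta p Mx J w' w / (tau p Mx J 0 w' w + u)))

/-- The constraint of the update step of Algorithm 2: weights that are `ε` (resp. `0`) both in `w`
and in its PSG measure `w'` are frozen. -/
def Face (ε : ℝ) (w' w : Fin N → ℝ) : Set (Fin N → ℝ) :=
  {z | (∀ i, w i = ε → w' i = ε → z i = ε) ∧ (∀ i, w i = 0 → w' i = 0 → z i = 0)}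

/-- `w` is a sequence of iterates of the hybrid algorithm, `T` being the number of boost steps and
`sg t` the SG measure (boost phase) or PSG measure (Algorithm 2) of `w t` that the algorithm uses.
The number `T` is arbitrary, so whatever test ends the boost phase is covered. Algorithm 2 is run
without its stopping test, so that there is an iterate for every `t`. -/
structure IsHybridRun (p ε r u : ℝ) (Mx : Fin N → Matrix (Fin k) (Fin k) ℝ)
    (J : Matrix (Fin q) (Fin k) ℝ) (T : ℕ) (w sg : ℕ → Fin N → ℝ) : Prop where
  /-- Initialization: `w⁰` is an SG measure of the uniform measure. -/
  init : IsSG p ε Mx J (w 0) (fun _ => 1 / (N : ℝ))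
  /-- The initial solution has a positive definite information matrix. -/
  init_posDef : (info Mx (w 0)).PosDef
  /-- Boost steps, at iterations `1, …, T`. -/
  boost_sg : ∀ t < T, IsSG p ε Mx J (sg t) (w t)
  boost : ∀ t < T, w (t + 1) =
    (1 - boostStep p r u Mx J (sg t) (w t)) • w t + boostStep p r u Mx J (sg t) (w t) • sg t
  /-- Algorithm 2, started at `w T`, at iterations `T + 1, T + 2, …`. -/
  update_psg : ∀ t ≥ T, IsPSG p ε Mx J (sg t) (w t)
  update : ∀ t ≥ T, Minimizes p ε Mx J (Face ε (sg t) (w t)) (w (t + 1))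

end PhiDesign

end

/-! Once Algorithm 2 runs, every iterate minimizes the objective over a face of the design polytope,
and there are only finitely many faces (`finite_range_Face`). The objective values are nonincreasing
because each iterate lies in its own face, so they are constant from some index `s` on
(`IsHybridRun.exists_forall_ge_eq`). Then `w s` is itself a minimizer over its face. The segment
towards its PSG measure stays in that face, so the directional derivative there is nonnegative
(`eta_nonneg_of_isMin`), and PSG minimality gives the same towards `w_hat`. If `w_hat` were strictly
better, `eta_neg` would make that derivative negative.

The analytic content is `eta_neg`. Where it matters, `Φ_p` is an increasing function of `Tr φ(Σ)`,
with `φ = log` or `φ(x) = x ^ p`. The derivative of this trace is computed in an eigenbasis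
(`hasDerivAt_spectralSum`) and bounded by the difference of the trace values
(`sum_slope_mul_covarDeriv_le`). The Jacobian may be rank deficient: the kernel of `J M⁻¹ Jᵀ` is
always that of `Jᵀ`, so zero eigenvalues of two such matrices match and never interact with nonzero
ones. -/

noncomputable section

namespace PhiDesign

open Matrix

/-! ### Comparison of the spectra of two symmetric matrices. -/

section Eigenbasis

variable {n : Type*} [Fintype n]

theorem dotProduct_mulVec_comm {B : Matrix n n ℝ} (hB : B.IsHermitian) (x y : n → ℝ) :
    x ⬝ᵥ B *ᵥ y = (B *ᵥ x) ⬝ᵥ y := by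
  rw [dotProduct_mulVec, ← mulVec_transpose, ← conjTranspose_eq_transpose_of_trivial, hB.eq]

variable [DecidableEq n]

/-- The `i`-th vector of the orthonormal eigenbasis of a symmetric matrix. -/
def eigvec {A : Matrix n n ℝ} (hA : A.IsHermitian) (i : n) : n → ℝ :=
  hA.eigenvectorBasis i

theorem mulVec_eigvec {A : Matrix n n ℝ} (hA : A.IsHermitian) (i : n) :
    A *ᵥ eigvec hA i = hA.eigenvalues i • eigvec hA i :=
  hA.mulVec_eigenvectorBasis i

theorem sum_dotProduct_eigvec_mul {A : Matrix n n ℝ} (hA : A.IsHermitian) (x y : n → ℝ) :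
    ∑ i, (x ⬝ᵥ eigvec hA i) * (eigvec hA i ⬝ᵥ y) = x ⬝ᵥ y := by
  have h := hA.eigenvectorBasis.sum_inner_mul_inner (WithLp.toLp 2 x) (WithLp.toLp 2 y)
  simp only [EuclideanSpace.inner_eq_star_dotProduct, star_trivial] at h
  rw [dotProduct_comm x y, ← h]
  refine Finset.sum_congr rfl fun i _ => ?_
  rw [dotProduct_comm x, dotProduct_comm _ y]
  rfl

theorem eigvec_dotProduct_self {A : Matrix n n ℝ} (hA : A.IsHermitian) (i : n) :
    eigvec hA i ⬝ᵥ eigvec hA i = 1 := by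
  have h := real_inner_self_eq_norm_sq (hA.eigenvectorBasis i)
  rw [hA.eigenvectorBasis.orthonormal.1 i, one_pow] at h
  exact h

/-- The squared inner products of the eigenbases of two symmetric matrices. -/
def overlap {A B : Matrix n n ℝ} (hA : A.IsHermitian) (hB : B.IsHermitian) (i j : n) : ℝ :=
  (eigvec hA i ⬝ᵥ eigvec hB j) ^ 2

section Overlap

variable {A B : Matrix n n ℝ} (hA : A.IsHermitian) (hB : B.IsHermitian)

theorem overlap_nonneg (i j : n) : 0 ≤ overlap hA hB i j := sq_nonneg _

theorem overlap_comm (i j : n) : overlap hA hB i j = overlap hB hA j i := by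
  rw [overlap, overlap, dotProduct_comm]

/-- Parseval. Together with `sum_overlap_left` this makes the overlaps doubly stochastic, so that
traces of functions of `A` and `B` can be compared pair by pair of eigenvalues. -/
theorem sum_overlap_right (i : n) : ∑ j, overlap hA hB i j = 1 := by
  rw [← eigvec_dotProduct_self hA i, ← sum_dotProduct_eigvec_mul hB]
  refine Finset.sum_congr rfl fun j _ => ?_
  rw [overlap, sq, dotProduct_comm (eigvec hB j)]

theorem sum_overlap_left (j : n) : ∑ i, overlap hA hB i j = 1 := by
  simp_rw [overlap_comm hA hB]
  exact sum_overlap_right hB hA j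

theorem eigvec_dotProduct_mulVec {B : Matrix n n ℝ} (hB : B.IsHermitian) (j : n) (y : n → ℝ) :
    eigvec hB j ⬝ᵥ B *ᵥ y = hB.eigenvalues j * (eigvec hB j ⬝ᵥ y) := by
  rw [dotProduct_mulVec_comm hB, mulVec_eigvec, smul_dotProduct, smul_eq_mul]

theorem sum_overlap_mul_eigenvalues (i : n) :
    ∑ j, overlap hA hB i j * hB.eigenvalues j = eigvec hA i ⬝ᵥ B *ᵥ eigvec hA i := by
  rw [← sum_dotProduct_eigvec_mul hB]
  refine Finset.sum_congr rfl fun j _ => ?_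
  rw [eigvec_dotProduct_mulVec, overlap, dotProduct_comm (eigvec hB j)]
  ring

/-- Both eigenvector equations give `v_j · (B - A) u_i = (b_j - a_i) (v_j · u_i)`. Summed over `i`,
the right side is the squared Frobenius norm of `B - A`. -/
theorem sum_overlap_mul_sub_sq (i : n) :
    ∑ j, overlap hA hB i j * (hB.eigenvalues j - hA.eigenvalues i) ^ 2 =
      ((B - A) *ᵥ eigvec hA i) ⬝ᵥ ((B - A) *ᵥ eigvec hA i) := by
  rw [← sum_dotProduct_eigvec_mul hB]
  refine Finset.sum_congr rfl fun j _ => ?_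
  have h : eigvec hB j ⬝ᵥ (B - A) *ᵥ eigvec hA i =
      (hB.eigenvalues j - hA.eigenvalues i) * (eigvec hB j ⬝ᵥ eigvec hA i) := by
    rw [sub_mulVec, dotProduct_sub, eigvec_dotProduct_mulVec, mulVec_eigvec, dotProduct_smul,
      smul_eq_mul]
    ring
  rw [dotProduct_comm _ (eigvec hB j), h, overlap, dotProduct_comm (eigvec hA i)]
  ring

/-- Eigenvectors for a zero and a nonzero eigenvalue are orthogonal if the kernels agree. -/
theorem overlap_eq_zero (hker : ∀ x, B *ᵥ x = 0 ↔ A *ᵥ x = 0) {i j : n}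
    (h : ¬(hA.eigenvalues i = 0 ↔ hB.eigenvalues j = 0)) : overlap hA hB i j = 0 := by
  rw [overlap, sq_eq_zero_iff]
  by_cases ha : hA.eigenvalues i = 0
  · have hb : hB.eigenvalues j ≠ 0 := fun hb => h ⟨fun _ => hb, fun _ => ha⟩
    have h0 : B *ᵥ eigvec hA i = 0 := (hker _).2 (by rw [mulVec_eigvec, ha, zero_smul])
    have h1 := eigvec_dotProduct_mulVec hB j (eigvec hA i)
    rw [h0, dotProduct_zero] at h1
    rw [dotProduct_comm]
    exact (mul_eq_zero.1 h1.symm).resolve_left hb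
  · have hb : hB.eigenvalues j = 0 := by
      by_contra hb
      exact h ⟨fun h => absurd h ha, fun h => absurd h hb⟩
    have h0 : A *ᵥ eigvec hB j = 0 := (hker _).1 (by rw [mulVec_eigvec, hb, zero_smul])
    have h1 := eigvec_dotProduct_mulVec hA i (eigvec hB j)
    rw [h0, dotProduct_zero] at h1
    exact (mul_eq_zero.1 h1.symm).resolve_left ha

end Overlap

/-- The trace of `φ(A)`: the sum of the values of `φ` at the eigenvalues of `A`. -/
def spectralSum (φ : ℝ → ℝ) (A : Matrix n n ℝ) : ℝ :=
  open Classical in if hA : A.IsHermitian then ∑ i, φ (hA.eigenvalues i) else 0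

theorem spectralSum_eq (φ : ℝ → ℝ) {A : Matrix n n ℝ} (hA : A.IsHermitian) :
    spectralSum φ A = ∑ i, φ (hA.eigenvalues i) :=
  dif_pos hA

theorem trace_cfc_eq_spectralSum (φ : ℝ → ℝ) {A : Matrix n n ℝ} (hA : A.IsHermitian) :
    (cfc φ A).trace = spectralSum φ A := by
  rw [spectralSum_eq φ hA, hA.cfc_eq, Matrix.IsHermitian.cfc, Unitary.conjStarAlgAut_apply,
    Matrix.trace_mul_cycle, Unitary.coe_star_mul_self, one_mul, Matrix.trace_diagonal]
  rfl

theorem spectralSum_sub (φ : ℝ → ℝ) {A B : Matrix n n ℝ} (hA : A.IsHermitian)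
    (hB : B.IsHermitian) :
    spectralSum φ B - spectralSum φ A =
      ∑ i, ∑ j, overlap hA hB i j * (φ (hB.eigenvalues j) - φ (hA.eigenvalues i)) := by
  simp_rw [mul_sub, Finset.sum_sub_distrib]
  rw [spectralSum_eq φ hA, spectralSum_eq φ hB, Finset.sum_comm]
  simp_rw [← Finset.sum_mul, sum_overlap_left, sum_overlap_right, one_mul]

/-- The scalar expansion is averaged with the overlaps as weights. It is needed only between nonzero
eigenvalues: mixed pairs have weight zero, and pairs of zeros contribute nothing. -/
theorem abs_spectralSum_sub_le {φ ψ : ℝ → ℝ} {A B : Matrix n n ℝ} (hA : A.IsHermitian)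
    (hB : B.IsHermitian) (hker : ∀ x, B *ᵥ x = 0 ↔ A *ᵥ x = 0) {K : ℝ}
    (hK : ∀ i j, hA.eigenvalues i ≠ 0 → hB.eigenvalues j ≠ 0 →
      |φ (hB.eigenvalues j) - φ (hA.eigenvalues i) -
        ψ (hA.eigenvalues i) * (hB.eigenvalues j - hA.eigenvalues i)| ≤
        K * (hB.eigenvalues j - hA.eigenvalues i) ^ 2) :
    |spectralSum φ B - spectralSum φ A -
      ∑ i, ψ (hA.eigenvalues i) * (eigvec hA i ⬝ᵥ (B - A) *ᵥ eigvec hA i)| ≤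
      K * ∑ i, ((B - A) *ᵥ eigvec hA i) ⬝ᵥ ((B - A) *ᵥ eigvec hA i) := by
  have h1 (i : n) : eigvec hA i ⬝ᵥ (B - A) *ᵥ eigvec hA i =
      ∑ j, overlap hA hB i j * (hB.eigenvalues j - hA.eigenvalues i) := by
    simp_rw [mul_sub, Finset.sum_sub_distrib, ← Finset.sum_mul, sum_overlap_right,
      sum_overlap_mul_eigenvalues, sub_mulVec, dotProduct_sub, mulVec_eigvec hA, dotProduct_smul,
      eigvec_dotProduct_self, smul_eq_mul]
    ring
  simp_rw [h1, ← sum_overlap_mul_sub_sq hA hB, spectralSum_sub φ hA hB, Finset.mul_sum,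
    ← Finset.sum_sub_distrib]
  refine (Finset.abs_sum_le_sum_abs _ _).trans (Finset.sum_le_sum fun i _ => ?_)
  refine (Finset.abs_sum_le_sum_abs _ _).trans (Finset.sum_le_sum fun j _ => ?_)
  by_cases hij : hA.eigenvalues i = 0 ↔ hB.eigenvalues j = 0
  · by_cases ha : hA.eigenvalues i = 0
    · simp [ha, hij.1 ha]
    · have hb : hB.eigenvalues j ≠ 0 := fun hb => ha (hij.2 hb)
      have := mul_le_mul_of_nonneg_left (hK i j ha hb) (overlap_nonneg hA hB i j)
      rw [← abs_of_nonneg (overlap_nonneg hA hB i j), ← abs_mul,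
        abs_of_nonneg (overlap_nonneg hA hB i j)] at this
      refine le_of_eq_of_le (congrArg _ ?_) (this.trans_eq ?_) <;> ring
  · simp [overlap_eq_zero hA hB hker hij]

end Eigenbasis

/-! ### Differentiation of `Tr φ(S)` along a curve of constant kernel. -/

section Derivative

variable {n : Type*} [Fintype n]

theorem hasDerivAt_mulVec_apply {S : ℝ → Matrix n n ℝ} {S' : Matrix n n ℝ} {t : ℝ}
    (hS : ∀ i j, HasDerivAt (fun α => S α i j) (S' i j) t) (A : Matrix n n ℝ) (x : n → ℝ) (i : n) :
    HasDerivAt (fun α => ((S α - A) *ᵥ x) i) ((S' *ᵥ x) i) t := by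
  simp only [mulVec, dotProduct, Matrix.sub_apply]
  exact HasDerivAt.fun_sum fun j _ => ((hS i j).sub_const (A i j)).mul_const (x j)

theorem hasDerivAt_dotProduct_mulVec {S : ℝ → Matrix n n ℝ} {S' : Matrix n n ℝ} {t : ℝ}
    (hS : ∀ i j, HasDerivAt (fun α => S α i j) (S' i j) t) (A : Matrix n n ℝ) (x y : n → ℝ) :
    HasDerivAt (fun α => x ⬝ᵥ (S α - A) *ᵥ y) (x ⬝ᵥ S' *ᵥ y) t := by
  simp only [dotProduct]
  exact HasDerivAt.fun_sum fun i _ => (hasDerivAt_mulVec_apply hS A y i).const_mul (x i)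

theorem hasDerivAt_sum_sq_sub {S : ℝ → Matrix n n ℝ} {S' : Matrix n n ℝ} {t : ℝ}
    (hS : ∀ i j, HasDerivAt (fun α => S α i j) (S' i j) t) (u : n → n → ℝ) :
    HasDerivAt (fun α => ∑ i, ((S α - S t) *ᵥ u i) ⬝ᵥ ((S α - S t) *ᵥ u i)) 0 t := by
  have h : HasDerivAt (fun α => ∑ i, ∑ j, ((S α - S t) *ᵥ u i) j * ((S α - S t) *ᵥ u i) j)
      (∑ i, ∑ j, ((S' *ᵥ u i) j * ((S t - S t) *ᵥ u i) j +
        ((S t - S t) *ᵥ u i) j * (S' *ᵥ u i) j)) t :=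
    HasDerivAt.fun_sum fun i _ => HasDerivAt.fun_sum fun j _ =>
      (hasDerivAt_mulVec_apply hS (S t) (u i) j).mul (hasDerivAt_mulVec_apply hS (S t) (u i) j)
  simpa [dotProduct] using h

variable [DecidableEq n]

/-- The nonzero eigenvalues of a matrix `B` near `A` with the same kernel stay in a compact
subinterval of the positive half-line. -/
theorem exists_eigenvalue_bounds {A : Matrix n n ℝ} (hA : A.PosSemidef) :
    ∃ m C : ℝ, 0 < m ∧ (∀ i, hA.1.eigenvalues i ≠ 0 → hA.1.eigenvalues i ∈ Set.Icc m C) ∧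
      ∀ (B : Matrix n n ℝ) (hB : B.IsHermitian), (∀ x, B *ᵥ x = 0 ↔ A *ᵥ x = 0) →
        (∑ i, ((B - A) *ᵥ eigvec hA.1 i) ⬝ᵥ ((B - A) *ᵥ eigvec hA.1 i) < m ^ 2) →
        ∀ j, hB.eigenvalues j ≠ 0 → hB.eigenvalues j ∈ Set.Icc m C := by
  -- The factor 2 leaves room: a number outside `[m, C + m]` is at distance at least `m` from every
  -- nonzero eigenvalue of `A`. The overlaps with such a nonzero eigenvalue of `B` sum to one and
  -- vanish at the zero eigenvalues of `A`, so the Frobenius distance would be at least `m`.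
  obtain ⟨m, hm, hmA⟩ : ∃ m : ℝ, 0 < m ∧ ∀ i, hA.1.eigenvalues i ≠ 0 → 2 * m ≤
      hA.1.eigenvalues i := by
    have h : ∀ i, ∀ᶠ m : ℝ in 𝓝[>] 0, hA.1.eigenvalues i ≠ 0 → 2 * m ≤ hA.1.eigenvalues i := by
      intro i
      by_cases h0 : hA.1.eigenvalues i = 0
      · simp [h0]
      · have hpos : 0 < hA.1.eigenvalues i / 2 :=
          half_pos (lt_of_le_of_ne (hA.eigenvalues_nonneg i) (Ne.symm h0))
        filter_upwards [Ioo_mem_nhdsGT hpos] with m hm _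
        linarith [hm.2]
    obtain ⟨m, hm, h0⟩ := ((eventually_all.2 h).and self_mem_nhdsWithin).exists
    exact ⟨m, h0, hm⟩
  obtain ⟨C, hC⟩ : ∃ C : ℝ, ∀ i, hA.1.eigenvalues i ≤ C :=
    ⟨∑ i, hA.1.eigenvalues i, fun i =>
      Finset.single_le_sum (fun j _ => hA.eigenvalues_nonneg j) (Finset.mem_univ i)⟩
  refine ⟨m, C + m, hm, fun i hi => ⟨by linarith [hmA i hi], by linarith [hC i]⟩,
    fun B hB hker he j hj => ?_⟩
  by_contra hout
  refine he.not_ge ?_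
  simp_rw [← sum_overlap_mul_sub_sq hA.1 hB]
  calc m ^ 2 = ∑ i, overlap hA.1 hB i j * m ^ 2 := by
        rw [← Finset.sum_mul, sum_overlap_left, one_mul]
    _ ≤ ∑ i, overlap hA.1 hB i j * (hB.eigenvalues j - hA.1.eigenvalues i) ^ 2 := by
        refine Finset.sum_le_sum fun i _ => ?_
        by_cases ha : hA.1.eigenvalues i = 0
        · rw [overlap_eq_zero hA.1 hB hker fun h => hj (h.1 ha), zero_mul, zero_mul]
        · refine mul_le_mul_of_nonneg_left (sq_le_sq.2 ?_) (overlap_nonneg _ _ _ _)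
          rw [abs_of_pos hm, le_abs]
          by_contra! hlt
          exact hout ⟨by linarith [hmA i ha], by linarith [hC i]⟩
    _ ≤ _ := by
        refine Finset.sum_le_sum fun i _ => ?_
        exact Finset.single_le_sum (f := fun j => overlap hA.1 hB i j *
          (hB.eigenvalues j - hA.1.eigenvalues i) ^ 2)
          (fun l _ => mul_nonneg (overlap_nonneg _ _ _ _) (sq_nonneg _)) (Finset.mem_univ j)

/-- `φ` has the first-order expansion with slope `ψ` and a quadratic error that is uniform on
compact subintervals of the positive half-line. -/
def HasQuadraticError (φ ψ : ℝ → ℝ) : Prop :=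
  ∀ m C : ℝ, 0 < m → ∃ K : ℝ, ∀ a ∈ Set.Icc m C, ∀ b ∈ Set.Icc m C,
    |φ b - φ a - ψ a * (b - a)| ≤ K * (b - a) ^ 2

/-- The mean value inequality is used twice, for `ψ` and then for `φ x - ψ a * x`. -/
theorem hasQuadraticError_of_hasDerivAt {φ ψ χ : ℝ → ℝ} (h1 : ∀ x, 0 < x → HasDerivAt φ (ψ x) x)
    (h2 : ∀ x, 0 < x → HasDerivAt ψ (χ x) x) (h3 : ContinuousOn χ (Set.Ioi 0)) :
    HasQuadraticError φ ψ := by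
  intro m C hm
  obtain ⟨K, hK⟩ := isCompact_Icc.exists_bound_of_continuousOn
    (h3.mono fun x (hx : x ∈ Set.Icc m C) => hm.trans_le hx.1)
  refine ⟨K, fun a ha b hb => ?_⟩
  have hK0 : 0 ≤ K := (norm_nonneg _).trans (hK a ha)
  have hsub : Set.uIcc a b ⊆ Set.Icc m C := Set.ordConnected_Icc.uIcc_subset ha hb
  have hψ : ∀ x ∈ Set.uIcc a b, ‖ψ x - ψ a‖ ≤ K * ‖b - a‖ := fun x hx => by
    refine ((convex_Icc m C).norm_image_sub_le_of_norm_hasDerivWithin_le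
      (fun y hy => (h2 y (hm.trans_le hy.1)).hasDerivWithinAt) hK ha (hsub hx)).trans ?_
    exact mul_le_mul_of_nonneg_left (Set.abs_sub_left_of_mem_uIcc hx) hK0
  have h := (convex_uIcc a b).norm_image_sub_le_of_norm_hasDerivWithin_le
    (f := fun x => φ x - ψ a * x) (f' := fun x => ψ x - ψ a)
    (fun x hx => ((h1 x (hm.trans_le (hsub hx).1)).sub
      (by simpa using (hasDerivAt_id x).const_mul (ψ a))).hasDerivWithinAt)
    hψ Set.left_mem_uIcc Set.right_mem_uIcc
  calc |φ b - φ a - ψ a * (b - a)| = ‖φ b - ψ a * b - (φ a - ψ a * a)‖ := by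
        rw [Real.norm_eq_abs]; ring_nf
    _ ≤ K * ‖b - a‖ * ‖b - a‖ := h
    _ = K * (b - a) ^ 2 := by rw [mul_assoc, ← sq, Real.norm_eq_abs, sq_abs]

theorem hasQuadraticError_log : HasQuadraticError Real.log fun x => x⁻¹ :=
  hasQuadraticError_of_hasDerivAt (χ := fun x => -(x ^ 2)⁻¹)
    (fun _ hx => Real.hasDerivAt_log hx.ne') (fun _ hx => hasDerivAt_inv hx.ne')
    (ContinuousOn.neg <| ContinuousOn.inv₀ (by fun_prop) fun _ hx => (pow_pos hx 2).ne')

theorem hasQuadraticError_rpow (p : ℝ) :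
    HasQuadraticError (fun x => x ^ p) fun x => p * x ^ (p - 1) :=
  hasQuadraticError_of_hasDerivAt (χ := fun x => p * ((p - 1) * x ^ (p - 1 - 1)))
    (fun _ hx => Real.hasDerivAt_rpow_const (Or.inl hx.ne'))
    (fun _ hx => (Real.hasDerivAt_rpow_const (Or.inl hx.ne')).const_mul p)
    (continuousOn_const.mul <| continuousOn_const.mul <|
      continuousOn_id.rpow_const fun _ hx => Or.inl (ne_of_gt hx))

/-- First-order perturbation of `Tr φ(S)` along a differentiable curve of positive semidefinite
matrices with constant kernel. -/
theorem hasDerivAt_spectralSum {φ ψ : ℝ → ℝ} (hφ : HasQuadraticError φ ψ)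
    {S : ℝ → Matrix n n ℝ} {S' : Matrix n n ℝ} {t : ℝ} (h0 : (S t).PosSemidef)
    (hpos : ∀ᶠ α in 𝓝 t, (S α).PosSemidef)
    (hker : ∀ᶠ α in 𝓝 t, ∀ x, S α *ᵥ x = 0 ↔ S t *ᵥ x = 0)
    (hS : ∀ i j, HasDerivAt (fun α => S α i j) (S' i j) t) :
    HasDerivAt (fun α => spectralSum φ (S α))
      (∑ i, ψ (h0.1.eigenvalues i) * (eigvec h0.1 i ⬝ᵥ S' *ᵥ eigvec h0.1 i)) t := by
  obtain ⟨m, C, hm, hA, hB⟩ := exists_eigenvalue_bounds h0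
  obtain ⟨K, hK⟩ := hφ m C hm
  set e : ℝ → ℝ := fun α =>
    ∑ i, ((S α - S t) *ᵥ eigvec h0.1 i) ⬝ᵥ ((S α - S t) *ᵥ eigvec h0.1 i) with he
  have hde : HasDerivAt e 0 t := hasDerivAt_sum_sq_sub hS _
  have het : e t = 0 := by simp [he]
  have hlt : ∀ᶠ α in 𝓝 t, e α < m ^ 2 :=
    hde.continuousAt.eventually_lt_const (by rw [het]; positivity)
  set D : ℝ → ℝ := fun α => ∑ i, ψ (h0.1.eigenvalues i) *
    (eigvec h0.1 i ⬝ᵥ (S α - S t) *ᵥ eigvec h0.1 i) with hD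
  have hdD : HasDerivAt D (∑ i, ψ (h0.1.eigenvalues i) *
      (eigvec h0.1 i ⬝ᵥ S' *ᵥ eigvec h0.1 i)) t :=
    HasDerivAt.fun_sum fun i _ => (hasDerivAt_dotProduct_mulVec hS (S t) _ _).const_mul _
  have hDt : D t = 0 := by simp [hD]
  -- The error is at most a multiple of `e`, which vanishes at `t` together with its derivative;
  -- hence it is of smaller order than `α - t`.
  have hbound : ∀ᶠ α in 𝓝 t, |spectralSum φ (S α) - spectralSum φ (S t) - D α| ≤ K * e α := by
    filter_upwards [hpos, hker, hlt] with α hp hk hl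
    exact abs_spectralSum_sub_le h0.1 hp.1 hk fun i j hi hj =>
      hK _ (hA i hi) _ (hB (S α) hp.1 hk hl j hj)
  have hR : HasDerivAt (fun α => spectralSum φ (S α) - spectralSum φ (S t) - D α) 0 t := by
    rw [hasDerivAt_iff_isLittleO] at hde ⊢
    simp only [het, hDt, sub_self, sub_zero, smul_zero] at hde ⊢
    refine (Asymptotics.IsBigO.of_bound |K| ?_).trans_isLittleO hde
    filter_upwards [hbound] with α hα
    rw [Real.norm_eq_abs, Real.norm_eq_abs, ← abs_mul]
    exact hα.trans (le_abs_self _)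
  have := (hR.add hdD).const_add (spectralSum φ (S t))
  rw [zero_add] at this
  refine this.congr_of_eventuallyEq (Eventually.of_forall fun α => ?_)
  simp only [Pi.add_apply]
  ring

end Derivative

/-! ### The gradient inequality for `Tr φ(J M⁻¹ Jᵀ)`. -/

section Descent

variable {m n : Type*} [Fintype m] [Fintype n]

section Sandwich

variable {M : Matrix m m ℝ} (J : Matrix n m ℝ)

theorem dotProduct_sandwich_mulVec (x y : n → ℝ) :
    x ⬝ᵥ (J * M * Jᵀ) *ᵥ y = (Jᵀ *ᵥ x) ⬝ᵥ M *ᵥ (Jᵀ *ᵥ y) := by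
  rw [← mulVec_mulVec, ← mulVec_mulVec, dotProduct_mulVec, ← mulVec_transpose]

theorem sandwich_mulVec_eq_zero_iff (hM : M.PosDef) (x : n → ℝ) :
    (J * M * Jᵀ) *ᵥ x = 0 ↔ Jᵀ *ᵥ x = 0 := by
  refine ⟨fun h => ?_, fun h => by rw [← mulVec_mulVec, h, mulVec_zero]⟩
  by_contra h0
  have h1 := hM.dotProduct_mulVec_pos h0
  rw [star_trivial, ← dotProduct_sandwich_mulVec, h, dotProduct_zero] at h1
  exact h1.false

theorem posSemidef_sandwich (hM : M.PosSemidef) : (J * M * Jᵀ).PosSemidef := by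
  simpa using hM.mul_mul_conjTranspose_same J

variable [DecidableEq m]

/-- This expands `(y - x)ᵀ M' (y - x) ≥ 0` for `y = M⁻¹ Jᵀ u` and `x = M'⁻¹ Jᵀ z`. The vector `z`
stays free, to be optimized later. -/
theorem two_mul_sub_le_dotProduct_sandwich {M' : Matrix m m ℝ} (hM : M.PosDef) (hM' : M'.PosDef) (u z : n → ℝ) :
    2 * (z ⬝ᵥ (J * M⁻¹ * Jᵀ) *ᵥ u) - z ⬝ᵥ (J * M'⁻¹ * Jᵀ) *ᵥ z ≤
      u ⬝ᵥ (J * (M⁻¹ * M' * M⁻¹) * Jᵀ) *ᵥ u := by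
  simp only [dotProduct_sandwich_mulVec]
  set y := M⁻¹ *ᵥ (Jᵀ *ᵥ u) with hy
  set x := M'⁻¹ *ᵥ (Jᵀ *ᵥ z) with hx
  have hdet : IsUnit M'.det := (isUnit_iff_isUnit_det _).1 hM'.isUnit
  have hM'x : M' *ᵥ x = Jᵀ *ᵥ z := by
    rw [hx, mulVec_mulVec, mul_nonsing_inv _ hdet, one_mulVec]
  have h1 : (Jᵀ *ᵥ u) ⬝ᵥ (M⁻¹ * M' * M⁻¹) *ᵥ (Jᵀ *ᵥ u) = y ⬝ᵥ M' *ᵥ y := by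
    rw [← mulVec_mulVec, ← mulVec_mulVec, dotProduct_mulVec_comm hM.inv.1]
  have h2 := hM'.posSemidef.dotProduct_mulVec_nonneg (y - x)
  rw [star_trivial, mulVec_sub, sub_dotProduct, dotProduct_sub, dotProduct_sub, hM'x,
    dotProduct_mulVec_comm hM'.1 x y, hM'x] at h2
  rw [h1, dotProduct_comm (Jᵀ *ᵥ z) x]
  rw [dotProduct_comm y (Jᵀ *ᵥ z)] at h2
  linarith [dotProduct_comm y (M' *ᵥ y), dotProduct_comm x (Jᵀ *ᵥ z)]

end Sandwich

variable [DecidableEq m] [DecidableEq n]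

theorem eigvec_dotProduct {A : Matrix n n ℝ} (hA : A.IsHermitian) (i j : n) :
    eigvec hA i ⬝ᵥ eigvec hA j = if i = j then 1 else 0 := by
  have h := orthonormal_iff_ite.1 hA.eigenvectorBasis.orthonormal j i
  rw [EuclideanSpace.inner_eq_star_dotProduct] at h
  simp only [eq_comm (a := i)]
  exact h

variable {M M' : Matrix m m ℝ} (J : Matrix n m ℝ)

/-- The derivative at `0` of `α ↦ J ((1 - α) M + α M')⁻¹ Jᵀ`. -/
def covarDeriv (J : Matrix n m ℝ) (M M' : Matrix m m ℝ) : Matrix n n ℝ :=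
  J * M⁻¹ * Jᵀ - J * (M⁻¹ * M' * M⁻¹) * Jᵀ

theorem dotProduct_covarDeriv_le (hM : M.PosDef) (hM' : M'.PosDef)
    (hA : (J * M⁻¹ * Jᵀ).IsHermitian) (hB : (J * M'⁻¹ * Jᵀ).IsHermitian) (i : n) :
    eigvec hA i ⬝ᵥ covarDeriv J M M' *ᵥ eigvec hA i ≤
      ∑ j, overlap hA hB i j *
        (hA.eigenvalues i - hA.eigenvalues i ^ 2 / hB.eigenvalues j) := by
  set u := eigvec hA i with hu
  set a := hA.eigenvalues i
  set b := hB.eigenvalues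
  -- These are the coordinates of the maximizer `z = a B⁺ u` of `2 a (z · u) - z · B z`, with `B⁺`
  -- the pseudoinverse. Division by zero gives the coefficient `0` on the kernel of `B`, as
  -- required.
  let c : n → ℝ := fun j => a / b j * (u ⬝ᵥ eigvec hB j)
  set z : n → ℝ := ∑ j, c j • eigvec hB j with hz
  have hzv : ∀ j, z ⬝ᵥ eigvec hB j = c j := fun j => by
    rw [hz, sum_dotProduct]
    simp [eigvec_dotProduct]
  have hzu : z ⬝ᵥ u = ∑ j, c j * (u ⬝ᵥ eigvec hB j) := by
    rw [← sum_dotProduct_eigvec_mul hB]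
    exact Finset.sum_congr rfl fun j _ => by rw [hzv, dotProduct_comm u]
  have hzz : z ⬝ᵥ (J * M'⁻¹ * Jᵀ) *ᵥ z = ∑ j, c j * (b j * c j) := by
    rw [← sum_dotProduct_eigvec_mul hB]
    exact Finset.sum_congr rfl fun j _ => by
      rw [eigvec_dotProduct_mulVec, dotProduct_comm _ z, hzv]
  have h := two_mul_sub_le_dotProduct_sandwich J hM hM' u z
  rw [hzz, mulVec_eigvec, dotProduct_smul, hzu, smul_eq_mul] at h
  have ha : u ⬝ᵥ (J * M⁻¹ * Jᵀ) *ᵥ u = ∑ j, overlap hA hB i j * a := by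
    rw [← Finset.sum_mul, sum_overlap_right, mulVec_eigvec, dotProduct_smul, hu,
      eigvec_dotProduct_self, smul_eq_mul]
    ring
  have hc : ∑ j, overlap hA hB i j * (a - a ^ 2 / b j) = (∑ j, overlap hA hB i j * a) -
      (2 * (a * ∑ j, c j * (u ⬝ᵥ eigvec hB j)) - ∑ j, c j * (b j * c j)) := by
    simp only [Finset.mul_sum, ← Finset.sum_sub_distrib]
    refine Finset.sum_congr rfl fun j _ => ?_
    simp only [c, overlap, ← hu]
    by_cases hb : b j = 0
    · simp [hb]
    · field_simp
      ring
  rw [hc, covarDeriv, sub_mulVec, dotProduct_sub, ha]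
  linarith

/-- The scalar inequality between `φ` and its derivative `ψ` that makes the directional derivative
of `Tr φ(J M⁻¹ Jᵀ)` at most the difference of its values. -/
def HasDescentSlope (φ ψ : ℝ → ℝ) : Prop :=
  ∀ a b : ℝ, 0 < a → 0 < b → 0 ≤ ψ a ∧ ψ a * (a - a ^ 2 / b) ≤ φ b - φ a

/-- The inequality in `HasDescentSlope` is the tangent line bound for `t ↦ φ (1 / t)` at `t = 1 /
a`, a form of convexity in the inverse variable. Here it reduces to `log x ≤ x - 1` at `x = a / b`.
-/
theorem hasDescentSlope_log : HasDescentSlope Real.log fun x => x⁻¹ := by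
  intro a b ha hb
  refine ⟨(inv_pos.2 ha).le, ?_⟩
  have h := Real.log_le_sub_one_of_pos (div_pos ha hb)
  rw [Real.log_div ha.ne' hb.ne'] at h
  have : a⁻¹ * (a - a ^ 2 / b) = 1 - a / b := by field_simp
  linarith

theorem hasDescentSlope_rpow {p : ℝ} (hp : 0 ≤ p) :
    HasDescentSlope (fun x => x ^ p) fun x => p * x ^ (p - 1) := by
  intro a b ha hb
  refine ⟨mul_nonneg hp (Real.rpow_nonneg ha.le _), ?_⟩
  have h1 := Real.log_le_sub_one_of_pos (div_pos ha hb)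
  have h2 := Real.add_one_le_exp (p * (Real.log b - Real.log a))
  have h3 : b ^ p = a ^ p * Real.exp (p * (Real.log b - Real.log a)) := by
    rw [Real.rpow_def_of_pos ha, Real.rpow_def_of_pos hb, ← Real.exp_add]
    ring_nf
  rw [Real.log_div ha.ne' hb.ne'] at h1
  have h4 : p * a ^ (p - 1) * (a - a ^ 2 / b) = a ^ p * (p * (1 - a / b)) := by
    rw [Real.rpow_sub_one ha.ne']
    field_simp
  have h5 : p * (1 - a / b) ≤ p * (Real.log b - Real.log a) :=
    mul_le_mul_of_nonneg_left (by linarith) hp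
  simp only [h4, h3]
  have := mul_le_mul_of_nonneg_left (h5.trans (le_sub_iff_add_le.2 h2)) (Real.rpow_nonneg ha.le p)
  linarith

theorem sum_slope_mul_covarDeriv_le {φ ψ : ℝ → ℝ} (hφ : HasDescentSlope φ ψ)
    (hM : M.PosDef) (hM' : M'.PosDef) (hA : (J * M⁻¹ * Jᵀ).PosSemidef) :
    ∑ i, ψ (hA.1.eigenvalues i) *
        (eigvec hA.1 i ⬝ᵥ covarDeriv J M M' *ᵥ eigvec hA.1 i) ≤
      spectralSum φ (J * M'⁻¹ * Jᵀ) - spectralSum φ (J * M⁻¹ * Jᵀ) := by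
  have hB := posSemidef_sandwich J hM'.inv.posSemidef
  have hker : ∀ x, (J * M'⁻¹ * Jᵀ) *ᵥ x = 0 ↔ (J * M⁻¹ * Jᵀ) *ᵥ x = 0 := fun x => by
    rw [sandwich_mulVec_eq_zero_iff J hM'.inv, sandwich_mulVec_eq_zero_iff J hM.inv]
  rw [spectralSum_sub φ hA.1 hB.1]
  refine Finset.sum_le_sum fun i _ => ?_
  by_cases ha : hA.1.eigenvalues i = 0
  -- An eigenvector for the eigenvalue zero is killed by `Jᵀ`, so it contributes nothing to the
  -- derivative, whatever the value of `ψ 0`.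
  · have h0 : Jᵀ *ᵥ eigvec hA.1 i = 0 := by
      rw [← sandwich_mulVec_eq_zero_iff J hM.inv, mulVec_eigvec, ha, zero_smul]
    rw [covarDeriv, sub_mulVec, dotProduct_sub, dotProduct_sandwich_mulVec,
      dotProduct_sandwich_mulVec, h0, zero_dotProduct, zero_dotProduct, sub_zero, mul_zero]
    refine Finset.sum_nonneg fun j _ => ?_
    by_cases hb : hB.1.eigenvalues j = 0
    · rw [ha, hb, sub_self, mul_zero]
    · rw [overlap_eq_zero hA.1 hB.1 hker fun h => hb (h.1 ha), zero_mul]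
  · have ha' := lt_of_le_of_ne (hA.eigenvalues_nonneg i) (Ne.symm ha)
    refine (mul_le_mul_of_nonneg_left (dotProduct_covarDeriv_le J hM hM' hA.1 hB.1 i)
      (hφ _ _ ha' ha').1).trans ?_
    rw [Finset.mul_sum]
    refine Finset.sum_le_sum fun j _ => ?_
    by_cases hb : hB.1.eigenvalues j = 0
    · rw [overlap_eq_zero hA.1 hB.1 hker fun h => ha (h.2 hb), zero_mul, zero_mul, mul_zero]
    · have hb' := lt_of_le_of_ne (hB.eigenvalues_nonneg j) (Ne.symm hb)
      rw [mul_left_comm]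
      exact mul_le_mul_of_nonneg_left (hφ _ _ ha' hb').2 (overlap_nonneg _ _ _ _)

end Descent

/-! ### Directional derivatives of the design criterion. -/

section Objective

section Perturbation

variable {m n : Type*} [Fintype m] [DecidableEq m]

theorem dotProduct_mulVec_self_eq_sum {A : Matrix m m ℝ} (hA : A.IsHermitian) (x : m → ℝ) :
    x ⬝ᵥ A *ᵥ x = ∑ i, hA.eigenvalues i * (x ⬝ᵥ eigvec hA i) ^ 2 := by
  rw [← sum_dotProduct_eigvec_mul hA]
  refine Finset.sum_congr rfl fun i _ => ?_
  rw [eigvec_dotProduct_mulVec, dotProduct_comm _ x]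
  ring

theorem dotProduct_self_eq_sum {A : Matrix m m ℝ} (hA : A.IsHermitian) (x : m → ℝ) :
    x ⬝ᵥ x = ∑ i, (x ⬝ᵥ eigvec hA i) ^ 2 := by
  rw [← sum_dotProduct_eigvec_mul hA]
  exact Finset.sum_congr rfl fun i _ => by rw [dotProduct_comm _ x, sq]

theorem exists_pos_mul_le_dotProduct_mulVec {M : Matrix m m ℝ} (hM : M.PosDef) :
    ∃ l : ℝ, 0 < l ∧ ∀ x, l * (x ⬝ᵥ x) ≤ x ⬝ᵥ M *ᵥ x := by
  have h : ∀ i, ∀ᶠ l : ℝ in 𝓝[>] 0, l ≤ hM.1.eigenvalues i := fun i => by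
    filter_upwards [Ioo_mem_nhdsGT (hM.eigenvalues_pos i)] with l hl using hl.2.le
  obtain ⟨l, hl, h0⟩ := ((eventually_all.2 h).and self_mem_nhdsWithin).exists
  refine ⟨l, h0, fun x => ?_⟩
  rw [dotProduct_mulVec_self_eq_sum hM.1, dotProduct_self_eq_sum hM.1, Finset.mul_sum]
  exact Finset.sum_le_sum fun i _ => mul_le_mul_of_nonneg_right (hl i) (sq_nonneg _)

theorem exists_dotProduct_mulVec_le {M : Matrix m m ℝ} (hM : M.PosSemidef) :
    ∃ C : ℝ, 0 ≤ C ∧ ∀ x, x ⬝ᵥ M *ᵥ x ≤ C * (x ⬝ᵥ x) := by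
  refine ⟨∑ i, hM.1.eigenvalues i, Finset.sum_nonneg fun i _ => hM.eigenvalues_nonneg i,
    fun x => ?_⟩
  rw [dotProduct_mulVec_self_eq_sum hM.1, dotProduct_self_eq_sum hM.1, Finset.mul_sum]
  exact Finset.sum_le_sum fun i _ => mul_le_mul_of_nonneg_right
    (Finset.single_le_sum (fun j _ => hM.eigenvalues_nonneg j) (Finset.mem_univ i)) (sq_nonneg _)

/-- Negative `α` is included because `eta` is a two-sided derivative. There the quadratic form is at
least `((1 - α) l + α C) (x ⬝ᵥ x)`, whose coefficient is positive near `0`. -/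
theorem eventually_posDef {M M' : Matrix m m ℝ} (hM : M.PosDef) (hM' : M'.PosSemidef) :
    ∀ᶠ α : ℝ in 𝓝 0, ((1 - α) • M + α • M').PosDef := by
  obtain ⟨l, hl, hMl⟩ := exists_pos_mul_le_dotProduct_mulVec hM
  obtain ⟨C, hC, hMC⟩ := exists_dotProduct_mulVec_le hM'
  have h1 : ∀ᶠ α : ℝ in 𝓝 0, α < 1 := eventually_lt_nhds one_pos
  have h2 : ∀ᶠ α : ℝ in 𝓝 0, 0 < (1 - α) * l + α * C := by
    have : ContinuousAt (fun α : ℝ => (1 - α) * l + α * C) 0 := by fun_prop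
    exact this.eventually_const_lt (by simpa using hl)
  filter_upwards [h1, h2] with α h1 h2
  rcases le_or_gt 0 α with h0 | h0
  · exact (hM.smul (sub_pos.2 h1)).add_posSemidef (hM'.smul h0)
  · refine PosDef.of_dotProduct_mulVec_pos ?_ fun x hx => ?_
    · rw [IsHermitian, conjTranspose_add, conjTranspose_smul, conjTranspose_smul, hM.1.eq,
        hM'.1.eq, star_trivial, star_trivial]
    · have hx0 : 0 < x ⬝ᵥ x := by simpa using dotProduct_star_self_pos_iff.2 hx
      rw [star_trivial, add_mulVec, smul_mulVec, smul_mulVec, dotProduct_add, dotProduct_smul,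
        dotProduct_smul, smul_eq_mul, smul_eq_mul]
      have h3 := mul_le_mul_of_nonneg_left (hMl x) (sub_pos.2 h1).le
      have h4 := mul_le_mul_of_nonpos_left (hMC x) h0.le
      have h5 := mul_pos h2 hx0
      linarith

theorem hasDerivAt_sandwich_inv {M M' : Matrix m m ℝ} (J : Matrix n m ℝ) (hM : M.PosDef)
    (i j : n) :
    HasDerivAt (fun α : ℝ => (J * ((1 - α) • M + α • M')⁻¹ * Jᵀ) i j)
      (covarDeriv J M M' i j) 0 := by
  let _ : NormedRing (Matrix m m ℝ) := Matrix.linftyOpNormedRing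
  let _ : NormedAlgebra ℝ (Matrix m m ℝ) := Matrix.linftyOpNormedAlgebra
  have hdet : IsUnit M.det := (isUnit_iff_isUnit_det _).1 hM.isUnit
  obtain ⟨v, rfl⟩ := hM.isUnit
  have hline : HasDerivAt (fun α : ℝ => (1 - α) • (v : Matrix m m ℝ) + α • M')
      (M' - v) 0 := by
    have := (((hasDerivAt_id (0 : ℝ)).const_sub 1).smul_const (v : Matrix m m ℝ)).add
      ((hasDerivAt_id (0 : ℝ)).smul_const M')
    refine this.congr_deriv ?_
    simp [sub_eq_neg_add]
  have hinv : HasFDerivAt Ring.inverse (-ContinuousLinearMap.mulLeftRight ℝ (Matrix m m ℝ)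
      ↑v⁻¹ ↑v⁻¹) ((1 - (0 : ℝ)) • (v : Matrix m m ℝ) + (0 : ℝ) • M') := by
    simpa using hasFDerivAt_ringInverse (𝕜 := ℝ) v
  let L : Matrix m m ℝ →ₗ[ℝ] ℝ :=
    { toFun := fun X => (J * X * Jᵀ) i j
      map_add' := fun X Y => by simp [Matrix.mul_add, Matrix.add_mul]
      map_smul' := fun c X => by simp }
  have h := (LinearMap.toContinuousLinearMap L).hasFDerivAt.comp_hasDerivAt (0 : ℝ)
    (hinv.comp_hasDerivAt (0 : ℝ) hline)
  have hL : (LinearMap.toContinuousLinearMap L : Matrix m m ℝ → ℝ) =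
    fun X => (J * X * Jᵀ) i j := rfl
  simp only [hL, Function.comp_def] at h
  simp only [nonsing_inv_eq_ringInverse]
  refine h.congr_deriv ?_
  rw [covarDeriv, ← coe_units_inv]
  simp only [_root_.neg_apply, ContinuousLinearMap.mulLeftRight_apply, coe_units_inv]
  rw [Matrix.mul_sub, Matrix.sub_mul, nonsing_inv_mul _ hdet, Matrix.one_mul, neg_sub]
  change (J * ((v : Matrix m m ℝ)⁻¹ -
    (v : Matrix m m ℝ)⁻¹ * M' * (v : Matrix m m ℝ)⁻¹) * Jᵀ) i j = _
  rw [Matrix.mul_sub, Matrix.sub_mul]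

end Perturbation

variable {N k q : ℕ} {Mx : Fin N → Matrix (Fin k) (Fin k) ℝ} {J : Matrix (Fin q) (Fin k) ℝ}

theorem info_line (w w' : Fin N → ℝ) (α : ℝ) :
    info Mx ((1 - α) • w + α • w') = (1 - α) • info Mx w + α • info Mx w' := by
  simp [info, add_smul, Finset.sum_add_distrib, Finset.smul_sum, mul_smul]

theorem info_posSemidef (hMx : ∀ i, (Mx i).PosSemidef) {w : Fin N → ℝ} (hw : ∀ i, 0 ≤ w i) :
    (info Mx w).PosSemidef :=
  posSemidef_sum _ fun i _ => (hMx i).smul (hw i)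

theorem covar_posSemidef {w : Fin N → ℝ} (hw : (info Mx w).PosDef) :
    (covar Mx J w).PosSemidef :=
  posSemidef_sandwich J hw.inv.posSemidef

theorem covar_mulVec_eq_zero_iff {w w' : Fin N → ℝ} (hw : (info Mx w).PosDef)
    (hw' : (info Mx w').PosDef) (x : Fin q → ℝ) :
    covar Mx J w *ᵥ x = 0 ↔ covar Mx J w' *ᵥ x = 0 :=
  (sandwich_mulVec_eq_zero_iff J hw.inv x).trans (sandwich_mulVec_eq_zero_iff J hw'.inv x).symm

theorem det_covar_eq_zero_iff {w w' : Fin N → ℝ} (hw : (info Mx w).PosDef)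
    (hw' : (info Mx w').PosDef) : (covar Mx J w).det = 0 ↔ (covar Mx J w').det = 0 := by
  simp_rw [← exists_mulVec_eq_zero_iff, covar_mulVec_eq_zero_iff hw hw']

theorem exists_hasDerivAt_spectralSum_covar {φ ψ : ℝ → ℝ} (h1 : HasQuadraticError φ ψ)
    (h2 : HasDescentSlope φ ψ) {w w' : Fin N → ℝ} (hw : (info Mx w).PosDef)
    (hw' : (info Mx w').PosDef) :
    ∃ D, HasDerivAt (fun α : ℝ => spectralSum φ (covar Mx J ((1 - α) • w + α • w'))) D 0 ∧
      D ≤ spectralSum φ (covar Mx J w') - spectralSum φ (covar Mx J w) := by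
  have h0 : (1 - (0 : ℝ)) • w + (0 : ℝ) • w' = w := by simp
  have hev : ∀ᶠ α : ℝ in 𝓝 0, (info Mx ((1 - α) • w + α • w')).PosDef := by
    simp_rw [info_line]
    exact eventually_posDef hw hw'.posSemidef
  -- The eigenvectors depend on the matrix, and the curve at `0` equals `covar Mx J w` only
  -- propositionally; a variable `S₀` permits the substitution.
  have key : ∀ S₀ : Matrix (Fin q) (Fin q) ℝ, S₀ = covar Mx J w → ∀ hS : S₀.PosSemidef,
      ∑ i, ψ (hS.1.eigenvalues i) * (eigvec hS.1 i ⬝ᵥ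
        covarDeriv J (info Mx w) (info Mx w') *ᵥ eigvec hS.1 i) ≤
      spectralSum φ (covar Mx J w') - spectralSum φ (covar Mx J w) := by
    rintro _ rfl hS
    exact sum_slope_mul_covarDeriv_le J h2 hw hw' hS
  have hS : (covar Mx J ((1 - (0 : ℝ)) • w + (0 : ℝ) • w')).PosSemidef := by
    rw [h0]
    exact covar_posSemidef hw
  refine ⟨_, hasDerivAt_spectralSum h1 (S' := covarDeriv J (info Mx w) (info Mx w'))
    (t := 0) (S := fun α => covar Mx J ((1 - α) • w + α • w')) hS (hev.mono fun α h => covar_posSemidef h)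
    (hev.mono fun α h x => ?_) fun i j => ?_, key _ (by rw [h0]) hS⟩
  · rw [h0]
    exact covar_mulVec_eq_zero_iff h hw x
  · simp only [covar, info_line]
    exact hasDerivAt_sandwich_inv J hw i j

theorem spectralSum_rpow_nonneg (p : ℝ) {S : Matrix (Fin q) (Fin q) ℝ} (hS : S.PosSemidef) :
    0 ≤ spectralSum (fun x => x ^ p) S := by
  rw [spectralSum_eq _ hS.1]
  exact Finset.sum_nonneg fun i _ => Real.rpow_nonneg (hS.eigenvalues_nonneg i) _

theorem Phi_of_ne_zero {p : ℝ} (hp : p ≠ 0) {S : Matrix (Fin q) (Fin q) ℝ} (hS : S.PosSemidef) :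
    Phi p S = ((q : ℝ)⁻¹ * spectralSum (fun x => x ^ p) S) ^ (1 / p) := by
  rw [Phi, if_neg hp, trace_cfc_eq_spectralSum _ hS.1]

theorem Phi_zero_of_det_ne_zero {S : Matrix (Fin q) (Fin q) ℝ} (hS : S.PosSemidef)
    (hdet : S.det ≠ 0) : Phi 0 S = Real.exp (spectralSum Real.log S * (1 / (q : ℝ))) := by
  have h := hS.1.det_eq_prod_eigenvalues
  simp only [RCLike.ofReal_real_eq_id, id] at h
  rw [Phi, if_pos rfl, Real.rpow_def_of_pos (lt_of_le_of_ne hS.det_nonneg hdet.symm),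
    spectralSum_eq _ hS.1, h, Real.log_prod]
  intro i _ hi
  exact hdet (h.trans (Finset.prod_eq_zero (Finset.mem_univ i) hi))

theorem Phi_nonneg (p : ℝ) {S : Matrix (Fin q) (Fin q) ℝ} (hS : S.PosSemidef) : 0 ≤ Phi p S := by
  by_cases hp : p = 0
  · rw [Phi, if_pos hp]
    exact Real.rpow_nonneg hS.det_nonneg _
  · rw [Phi_of_ne_zero hp hS]
    exact Real.rpow_nonneg (mul_nonneg (by positivity) (spectralSum_rpow_nonneg p hS)) _

/-- The directional derivative towards a strictly better design is negative. -/
theorem eta_neg (hq : 1 ≤ q) {p : ℝ} (hp : 0 ≤ p) {w w' : Fin N → ℝ}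
    (hw : (info Mx w).PosDef) (hw' : (info Mx w').PosDef)
    (h : objective p Mx J w' < objective p Mx J w) : eta p Mx J w' w < 0 := by
  have hq0 : 0 < (q : ℝ) := by exact_mod_cast hq
  have hS := covar_posSemidef (J := J) hw
  have hS' := covar_posSemidef (J := J) hw'
  have hev : ∀ᶠ α : ℝ in 𝓝 0, (info Mx ((1 - α) • w + α • w')).PosDef := by
    simp_rw [info_line]
    exact eventually_posDef hw hw'.posSemidef
  have h0 : (1 - (0 : ℝ)) • w + (0 : ℝ) • w' = w := by simp
  rw [objective, objective] at h
  rcases hp.eq_or_lt with rfl | hp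
  -- A singular covariance has criterion value `0`, and nothing is strictly better.
  · have hdet : (covar Mx J w).det ≠ 0 := fun hdet => by
      refine (h.trans_le' (Phi_nonneg 0 hS')).ne' ?_
      rw [Phi, if_pos rfl, hdet, Real.zero_rpow (by positivity)]
    have hdet' : (covar Mx J w').det ≠ 0 := (det_covar_eq_zero_iff hw hw').not.1 hdet
    obtain ⟨D, hD, hle⟩ := exists_hasDerivAt_spectralSum_covar (J := J) hasQuadraticError_log
      hasDescentSlope_log hw hw'
    rw [Phi_zero_of_det_ne_zero hS hdet, Phi_zero_of_det_ne_zero hS' hdet', Real.exp_lt_exp,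
      mul_lt_mul_iff_left₀ (by positivity)] at h
    have hal : HasDerivAt (along 0 Mx J w' w) _ 0 :=
      (hD.mul_const (1 / (q : ℝ))).exp.congr_of_eventuallyEq (hev.mono fun α hα =>
        Phi_zero_of_det_ne_zero (covar_posSemidef hα) ((det_covar_eq_zero_iff hw hα).not.1 hdet))
    rw [eta, hal.deriv]
    exact mul_neg_of_pos_of_neg (Real.exp_pos _)
      (mul_neg_of_neg_of_pos (by linarith) (by positivity))
  · obtain ⟨D, hD, hle⟩ := exists_hasDerivAt_spectralSum_covar (J := J) (hasQuadraticError_rpow p)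
      (hasDescentSlope_rpow hp.le) hw hw'
    rw [Phi_of_ne_zero hp.ne' hS, Phi_of_ne_zero hp.ne' hS', Real.rpow_lt_rpow_iff
      (mul_nonneg (by positivity) (spectralSum_rpow_nonneg p hS'))
      (mul_nonneg (by positivity) (spectralSum_rpow_nonneg p hS)) (by positivity),
      mul_lt_mul_iff_right₀ (by positivity)] at h
    -- Strict improvement excludes the base `0`, where the outer power `1 / p` may fail to be
    -- differentiable.
    have hpos : 0 < (q : ℝ)⁻¹ * spectralSum (fun x => x ^ p) (covar Mx J w) :=
      mul_pos (by positivity) (h.trans_le' (spectralSum_rpow_nonneg p hS'))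
    have hal : HasDerivAt (along p Mx J w' w) _ 0 :=
      ((hD.const_mul (q : ℝ)⁻¹).rpow_const (p := 1 / p)
        (Or.inl (by rw [h0]; exact hpos.ne'))).congr_of_eventuallyEq (hev.mono fun α hα =>
          Phi_of_ne_zero hp.ne' (covar_posSemidef hα))
    rw [eta, hal.deriv, h0]
    exact mul_neg_of_neg_of_pos (mul_neg_of_neg_of_pos
      (mul_neg_of_pos_of_neg (by positivity) (by linarith)) (by positivity))
      (Real.rpow_pos_of_pos hpos _)

end Objective

/-! ### Faces, monotonicity and finite termination of the objective values. -/

section Algorithm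

variable {N k q : ℕ} {Mx : Fin N → Matrix (Fin k) (Fin k) ℝ} {J : Matrix (Fin q) (Fin k) ℝ}
  {p ε r u : ℝ}

/-- As `α < 1`, a positive multiple of `M(w)` survives, so `M(w')` may be singular. This covers the
boost steps, whose length is at most `r < 1`. -/
theorem line_mem_OmegaPos (hMx : ∀ i, (Mx i).PosSemidef) {w w' : Fin N → ℝ}
    (hw : w ∈ OmegaPos Mx ε) (hw' : w' ∈ Omega N ε) {α : ℝ} (h0 : 0 ≤ α) (h1 : α < 1) :
    (1 - α) • w + α • w' ∈ OmegaPos Mx ε := by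
  refine ⟨⟨fun i => ?_, ?_⟩, ?_⟩
  · obtain ⟨ha, hb⟩ := hw.1.1 i
    obtain ⟨ha', hb'⟩ := hw'.1 i
    have h2 := sub_pos.2 h1
    simp only [Pi.add_apply, Pi.smul_apply, smul_eq_mul]
    constructor
    · positivity
    · nlinarith
  · simp only [Pi.add_apply, Pi.smul_apply, smul_eq_mul, Finset.sum_add_distrib,
      ← Finset.mul_sum, hw.1.2, hw'.2]
    ring
  · rw [info_line]
    exact (hw.2.smul (sub_pos.2 h1)).add_posSemidef
      ((info_posSemidef hMx fun i => (hw'.1 i).1).smul h0)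

theorem self_mem_Face (w w' : Fin N → ℝ) : w ∈ Face ε w' w :=
  ⟨fun _ h _ => h, fun _ h _ => h⟩

theorem line_mem_Face (w w' : Fin N → ℝ) (α : ℝ) : (1 - α) • w + α • w' ∈ Face ε w' w := by
  refine ⟨fun i h h' => ?_, fun i h h' => ?_⟩ <;>
  · simp only [Pi.add_apply, Pi.smul_apply, smul_eq_mul, h, h']
    ring

/-- A measure that minimizes the objective over its own face has nonnegative directional
derivative in the direction that determines the face. -/
theorem eta_nonneg_of_isMin (hMx : ∀ i, (Mx i).PosSemidef) {w w' : Fin N → ℝ}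
    (hw : w ∈ OmegaPos Mx ε) (hw' : w' ∈ Omega N ε)
    (h : ∀ z ∈ Face ε w' w ∩ OmegaPos Mx ε, objective p Mx J w ≤ objective p Mx J z) :
    0 ≤ eta p Mx J w' w := by
  rw [eta]
  by_cases hd : DifferentiableAt ℝ (along p Mx J w' w) 0
  · have ht := (hasDerivAt_iff_tendsto_slope.1 hd.hasDerivAt).mono_left
      (nhdsWithin_mono 0 fun x (hx : x ∈ Set.Ioi (0 : ℝ)) => ne_of_gt hx)
    refine ge_of_tendsto ht ?_
    filter_upwards [Ioo_mem_nhdsGT one_pos] with α hα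
    rw [slope_def_field, sub_zero]
    refine div_nonneg (sub_nonneg.2 ?_) hα.1.le
    have := h _ ⟨line_mem_Face w w' α, line_mem_OmegaPos hMx hw hw' hα.1.le hα.2⟩
    simpa [along] using this
  -- Without differentiability `deriv` takes the default value `0`, which is nonnegative.
  · rw [deriv_zero_of_not_differentiableAt hd]

theorem boostStep_mem (hr0 : 0 < r) (w' w : Fin N → ℝ) :
    0 ≤ boostStep p r u Mx J w' w ∧ boostStep p r u Mx J w' w ≤ r :=
  ⟨le_min hr0.le (le_max_left _ _), min_le_left _ _⟩

theorem IsHybridRun.mem_OmegaPos (hMx : ∀ i, (Mx i).PosSemidef) (hr0 : 0 < r) (hr1 : r < 1)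
    {T : ℕ} {w sg : ℕ → Fin N → ℝ} (hrun : IsHybridRun p ε r u Mx J T w sg) (t : ℕ) :
    w t ∈ OmegaPos Mx ε := by
  induction t with
  | zero => exact ⟨hrun.init.1, hrun.init_posDef⟩
  | succ t ih =>
    rcases lt_or_ge t T with ht | ht
    · rw [hrun.boost t ht]
      obtain ⟨h0, h1⟩ := boostStep_mem (p := p) (u := u) (Mx := Mx) (J := J) hr0 (sg t) (w t)
      exact line_mem_OmegaPos hMx ih (hrun.boost_sg t ht).1 h0 (h1.trans_lt hr1)
    · exact (hrun.update t ht).1.2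

/-- A face is determined by its two sets of frozen indices. -/
theorem finite_range_Face (w sg : ℕ → Fin N → ℝ) :
    (Set.range fun t => Face ε (sg t) (w t)).Finite := by
  refine (Set.finite_range fun s : Set (Fin N) × Set (Fin N) =>
    {z : Fin N → ℝ | (∀ i ∈ s.1, z i = ε) ∧ ∀ i ∈ s.2, z i = 0}).subset ?_
  rintro _ ⟨t, rfl⟩
  refine ⟨({i | w t i = ε ∧ sg t i = ε}, {i | w t i = 0 ∧ sg t i = 0}), ?_⟩
  simp [Face]

theorem Minimizes.objective_eq_sInf {C : Set (Fin N → ℝ)} {w : Fin N → ℝ}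
    (h : Minimizes p ε Mx J C w) :
    objective p Mx J w = sInf (objective p Mx J '' (C ∩ OmegaPos Mx ε)) := by
  refine (IsLeast.csInf_eq ⟨Set.mem_image_of_mem _ h.1, ?_⟩).symm
  rintro _ ⟨z, hz, rfl⟩
  exact h.2 z hz

theorem exists_forall_ge_eq_of_antitone {f : ℕ → ℝ} (hf : Antitone f)
    (hfin : (Set.range f).Finite) : ∃ s, ∀ t ≥ s, f t = f s := by
  obtain ⟨_, ⟨s, rfl⟩, hs⟩ := Set.exists_min_image _ id hfin (Set.range_nonempty f)
  exact ⟨s, fun t ht => (hf ht).antisymm (hs _ ⟨t, rfl⟩)⟩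

/-- After finitely many iterations the objective values of a run are constant. -/
theorem IsHybridRun.exists_forall_ge_eq (hMx : ∀ i, (Mx i).PosSemidef) (hr0 : 0 < r) (hr1 : r < 1)
    {T : ℕ} {w sg : ℕ → Fin N → ℝ} (hrun : IsHybridRun p ε r u Mx J T w sg) :
    ∃ s ≥ T, ∀ t ≥ s, objective p Mx J (w t) = objective p Mx J (w s) := by
  -- The shift by one is needed because `w T` comes from the boost phase or the initialization and
  -- need not minimize over a face.
  have hanti : Antitone fun t => objective p Mx J (w (T + t + 1)) :=
    antitone_nat_of_succ_le fun t => (hrun.update (T + (t + 1)) (by lia)).2 _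
      ⟨self_mem_Face _ _, hrun.mem_OmegaPos hMx hr0 hr1 _⟩
  have hfin : (Set.range fun t => objective p Mx J (w (T + t + 1))).Finite := by
    refine ((finite_range_Face (ε := ε) w sg).image fun C =>
      sInf (objective p Mx J '' (C ∩ OmegaPos Mx ε))).subset ?_
    rintro _ ⟨t, rfl⟩
    exact ⟨_, ⟨T + t, rfl⟩, (hrun.update (T + t) (by lia)).objective_eq_sInf.symm⟩
  obtain ⟨s, hs⟩ := exists_forall_ge_eq_of_antitone hanti hfin
  refine ⟨T + s + 1, by lia, fun t ht => ?_⟩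
  obtain ⟨d, rfl⟩ : ∃ d, t = T + d + 1 := ⟨t - T - 1, by lia⟩
  exact hs d (by lia)

end Algorithm

end PhiDesign

end

theorem mainTheorem9 {N k q : ℕ} (hq : 1 ≤ q) (hqk : q ≤ k)
    (Mx : Fin N → Matrix (Fin k) (Fin k) ℝ) (hMx : ∀ i, (Mx i).PosSemidef)
    (g : (Fin k → ℝ) → (Fin q → ℝ)) (θ : Fin k → ℝ) (hg : DifferentiableAt ℝ g θ)
    (p ε r u : ℝ) (hp : 0 ≤ p) (hε0 : 0 < ε) (hε1 : ε < 1)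
    (hr0 : 0 < r) (hr1 : r < 1) (hu : 0 < u)
    (T : ℕ) (w sg : ℕ → Fin N → ℝ)
    (hrun : PhiDesign.IsHybridRun p ε r u Mx (PhiDesign.jacobian g θ) T w sg)
    (w_hat : Fin N → ℝ) (hw_hat : PhiDesign.Solves p ε Mx (PhiDesign.jacobian g θ) w_hat) :
    Tendsto (fun t => PhiDesign.objective p Mx (PhiDesign.jacobian g θ) (w t)) atTop
      (𝓝 (PhiDesign.objective p Mx (PhiDesign.jacobian g θ) w_hat)) := by
  obtain ⟨s, hsT, hs⟩ := hrun.exists_forall_ge_eq hMx hr0 hr1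
  have hmem := hrun.mem_OmegaPos hMx hr0 hr1 s
  have hopt : PhiDesign.objective p Mx (PhiDesign.jacobian g θ) (w s) =
      PhiDesign.objective p Mx (PhiDesign.jacobian g θ) w_hat := by
    refine le_antisymm ?_ (hw_hat.2 _ ⟨Set.mem_univ _, hmem⟩)
    by_contra! hlt
    have hneg := PhiDesign.eta_neg hq hp hmem.2 hw_hat.1.2.2 hlt
    -- The value does not change from `s` to `s + 1`, so `w s` already attains the minimum over its
    -- face.
    have hnonneg := PhiDesign.eta_nonneg_of_isMin hMx hmem (hrun.update_psg s hsT).1.1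
      (fun z hz => (hs (s + 1) (Nat.le_succ s)).symm.trans_le ((hrun.update s hsT).2 z hz))
    exact (hneg.trans_le hnonneg).not_ge ((hrun.update_psg s hsT).2 _ hw_hat.1.2)
  exact tendsto_const_nhds.congr' ((eventually_ge_atTop s).mono fun t ht =>
    (hopt.symm.trans (hs t ht).symm))
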